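/- Let $B$ be a complete Boolean algebra, and let $\tau_{\omega\text{-}coh}$ be the Grothendieck topology on $B$ (regarded as a category) in which a sieve on $b$ covers iff it contains finitely many (possibly zero) elements whose join is $b$. Then the topos $Sh(B,\tau_{\omega\text{-}coh})$ of sheaves of sets can realize $\omega$-types. That is: for every small coherent category $\mathcal{C}$ and every coherent functor $p:Sub_{\mathcal{C}}(1)\to Sh(B,\tau_{\omega\text{-}coh})$, where $Sub_{\mathcal{C}}(1)$ is the poset of subobjects of the terminal object of $\mathcal{C}$, there is a coherent functor $M:\mathcal{C}\to Sh(B,\tau_{\omega\text{-}coh})$ with $p\leq M|_{Sub_{\mathcal{C}}(1)}$. (Both $p(u)$ and $M(u)$ are subobjects of the terminal sheaf for $u\in Sub_{\mathcal{C}}(1)$, and $\leq$ means $p(u)\subseteq M(u)$ for all $u$; equivalently, there is a natural transformation $p\Rightarrow M|_{Sub_{\mathcal{C}}(1)}$.) Here a category is coherent if it has finite limits, pullback-stable (regular epi, mono)-factorizations, and pullback-stable finite unions of subobjects (including the empty union); a functor between coherent categories is coherent if it preserves finite limits, regular epimorphisms and finite unions of subobjects. -/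

import Mathlib

open CategoryTheory CategoryTheory.Limits

/-- A coherent category: a regular category (finite limits, coequalizers of kernel pairs,
pullback-stable regular epimorphisms) in which every poset of subobjects has a least element and
binary joins, and these finite joins are stable under pullback. -/
class CoherentCategory.{v, u} (C : Type u) [Category.{v} C] : Prop extends Regular C where
  exists_stable_bot (X : C) : ∃ b : Subobject X, IsBot b ∧
    ∀ (Y : C) (f : Y ⟶ X), IsBot ((Subobject.pullback f).obj b)
  exists_stable_sup (X : C) (a b : Subobject X) : ∃ c : Subobject X, IsLUB {a, b} c ∧
    ∀ (Y : C) (f : Y ⟶ X),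
      IsLUB {(Subobject.pullback f).obj a, (Subobject.pullback f).obj b}
        ((Subobject.pullback f).obj c)

/-- The action of a finite limit preserving functor on subobjects. -/
noncomputable def mapSubobject.{v₁, v₂, u₁, u₂} {C : Type u₁} [Category.{v₁} C]
    {D : Type u₂} [Category.{v₂} D] (F : C ⥤ D) [PreservesFiniteLimits F] {X : C}
    (a : Subobject X) : Subobject (F.obj X) :=
  Subobject.mk (F.map a.arrow)

/-- A coherent functor: it preserves finite limits, regular epimorphisms, and finite joins of
subobjects (the empty join and the binary ones). -/
class CoherentFunctor.{v₁, v₂, u₁, u₂} {C : Type u₁} [Category.{v₁} C]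
    {D : Type u₂} [Category.{v₂} D] (F : C ⥤ D) : Prop extends PreservesFiniteLimits F where
  map_regularEpi {X Y : C} (f : X ⟶ Y) : IsRegularEpi f → IsRegularEpi (F.map f)
  map_bot {X : C} (b : Subobject X) : IsBot b → IsBot (mapSubobject F b)
  map_sup {X : C} (a b c : Subobject X) : IsLUB {a, b} c →
    IsLUB {mapSubobject F a, mapSubobject F b} (mapSubobject F c)

/-- The topology of finite unions on a bounded distributive lattice, regarded as a category: a
sieve on `b` covers if it contains finitely many elements whose join is `b`. -/
def finiteJoinTopology.{u} (B : Type u) [DistribLattice B] [BoundedOrder B] :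
    GrothendieckTopology B where
  sieves b := {S | ∃ s : Finset B, (∀ a ∈ s, ∃ f : a ⟶ b, S.arrows f) ∧ s.sup id = b}
  top_mem' b := ⟨{b}, fun a ha => by
    obtain rfl := Finset.mem_singleton.1 ha
    exact ⟨𝟙 a, trivial⟩, by simp⟩
  pullback_stable' := by
    classical
    rintro b c S f ⟨s, hs, hsup⟩
    refine ⟨s.image (c ⊓ ·), fun a ha => ?_, ?_⟩
    · obtain ⟨x, hx, rfl⟩ := Finset.mem_image.1 ha
      obtain ⟨g, hg⟩ := hs x hx
      refine ⟨homOfLE inf_le_left, ?_⟩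
      have h := S.downward_closed hg (homOfLE (inf_le_right : c ⊓ x ≤ x))
      rwa [Sieve.pullback_apply, Subsingleton.elim (homOfLE _ ≫ f) (homOfLE inf_le_right ≫ g)]
    · have h := Finset.sup_inf_distrib_left s id c
      rw [hsup, inf_eq_left.2 (leOfHom f)] at h
      rw [Finset.sup_image]
      exact h.symm
  transitive' := by
    classical
    rintro b S ⟨s, hs, hsup⟩ R hR
    have key : ∀ a : B, ∃ t : Finset B, a ∈ s →
        (∀ x ∈ t, ∃ f : x ⟶ b, R.arrows f) ∧ t.sup id = a := by
      intro a
      by_cases ha : a ∈ s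
      · obtain ⟨f, hf⟩ := hs a ha
        obtain ⟨t, ht, htsup⟩ := hR hf
        exact ⟨t, fun _ => ⟨fun x hx => (ht x hx).elim fun g hg => ⟨g ≫ f, hg⟩, htsup⟩⟩
      · exact ⟨∅, fun h => absurd h ha⟩
    choose t ht using key
    refine ⟨s.biUnion t, fun x hx => ?_, ?_⟩
    · obtain ⟨a, ha, hxa⟩ := Finset.mem_biUnion.1 hx
      exact (ht a ha).1 x hxa
    · rw [Finset.sup_biUnion, ← hsup]
      exact Finset.sup_congr rfl fun a ha => (ht a ha).2

/-- `E` can realize `ω`-types: for every small coherent category `C`, every coherent functor `p`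
from the poset of subobjects of the terminal object of `C` to `E` is dominated by the restriction
of a coherent functor `M : C ⥤ E`. As `p` takes subterminal values, the order `p ≤ M` is the
existence of a (necessarily unique) natural transformation. -/
def CanRealizeTypes.{u, w} (E : Type w) [Category.{u} E] : Prop :=
  ∀ (C : Type u) [SmallCategory C] [CoherentCategory C] (p : Subobject (⊤_ C) ⥤ E),
    CoherentFunctor p →
      ∃ M : C ⥤ E, CoherentFunctor M ∧ Nonempty (p ⟶ Subobject.underlying ⋙ M)

universe u

/-!
The two ingredients are the completeness theorem for coherent logic and the injectivity of complete
Boolean algebras.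

Let `p` be a coherent functor from the subterminal objects of `C` to sheaves on `B`. At each point
`x` of the Stone space `S` of `B`, the subterminal objects `a` such that `p a` contains `x` form a
proper filter. By completeness (`exists_isSetModel`) there is a model `N x : C ⥤ Type u` in which
all of them are inhabited. These models are unrelated for different `x`, so they only form a model
in sheaves on the discrete set `S`, equivalently a coherent functor to sheaves on the power set
`Set S` with finite covers, whose sections over `A` are the families indexed by `A`. But `B` is
complete, so the inclusion of `B` in `Set S` has a retraction, and pulling back along it gives a
model in sheaves on `B`.

The retraction is encoded as a filter `G` on `S` which is minimal among those that separate elements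
of `B`; modulo `G`, every set of points is given by an element of `B`
(`exists_eventually_iff_mem_stoneSet`). The sections over `b` of the pulled back model at `X` are
the germs, along the trace of `G` on the clopen set of `b`, of partial sections of the family
`(N x).obj X` (`germSheaf`). If `p a` has a section over `b`, then `(N x).obj a` is inhabited for
all points `x` of `b`, so this model has a section over `b` at `a`.

The completeness theorem is proved by a Henkin construction using only Zorn's lemma. A condition is
an object of `C` with a jointly monic family of morphisms to the sorts of finitely many names. A
filter of conditions pro-represents a functor that preserves finite limits. Each lifting problem
along a morphism to a condition has its own reserved name, and a filter may mention this name only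
if it solves the problem. Names of unsolved problems are thus fresh, so a filter that is maximal
among those consisting of nonempty objects solves all lifting problems along regular
epimorphisms (`exists_solves_of_maximal`); it is also prime (`restrict_mem_or_of_maximal`), and so
it pro-represents a model.
-/

/-! ### Empty objects and covers in a coherent category -/

section Coherent

variable {C : Type u} [SmallCategory C] [CoherentCategory C]

/-- An object of a coherent category is empty if its improper subobject is the least one;
equivalently, if it is a (strict) initial object. -/
def IsEmptyObject (A : C) : Prop := IsBot (⊤ : Subobject A)

theorem isBot_pullback {X Y : C} (f : Y ⟶ X) {b : Subobject X} (hb : IsBot b) :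
    IsBot ((Subobject.pullback f).obj b) := by
  obtain ⟨c, hc, hf⟩ := CoherentCategory.exists_stable_bot X
  obtain rfl : c = b := (hc b).antisymm (hb c)
  exact hf Y f

theorem isLUB_pullback {X Y : C} (f : Y ⟶ X) {a b c : Subobject X} (h : IsLUB {a, b} c) :
    IsLUB {(Subobject.pullback f).obj a, (Subobject.pullback f).obj b}
      ((Subobject.pullback f).obj c) := by
  obtain ⟨d, hd, hf⟩ := CoherentCategory.exists_stable_sup X a b
  rw [h.unique hd]
  exact hf Y f

theorem IsEmptyObject.of_hom {A B : C} (hB : IsEmptyObject B) (f : A ⟶ B) : IsEmptyObject A := by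
  have h := isBot_pullback f hB
  rwa [Subobject.pullback_top] at h

theorem IsEmptyObject.of_isRegularEpi {A B : C} (hA : IsEmptyObject A) (f : A ⟶ B)
    [IsRegularEpi f] : IsEmptyObject B := by
  obtain ⟨b, hb, hf⟩ := CoherentCategory.exists_stable_bot B
  have htop : (Subobject.pullback f).obj b = ⊤ := top_le_iff.1 (hA _)
  have : IsIso ((Subobject.pullback f).obj b).arrow :=
    (Subobject.isIso_arrow_iff_eq_top _).2 htop
  -- `f` factors through the least subobject `b`, hence `b` is everything
  have hfac : (inv ((Subobject.pullback f).obj b).arrow ≫ Subobject.pullbackπ f b) ≫ b.arrow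
      = f := by
    rw [Category.assoc, (Subobject.isPullback f b).w, IsIso.inv_hom_id_assoc]
  have hb' : IsIso b.arrow :=
    ExtremalEpi.isIso (f := f) _ _ hfac
  intro S
  rw [← (Subobject.isIso_arrow_iff_eq_top b).1 hb']
  exact hb S

theorem pullback_arrow_self {X : C} (b : Subobject X) :
    (Subobject.pullback b.arrow).obj b = ⊤ := by
  have := Subobject.pullback_self b.arrow
  rwa [Subobject.mk_arrow] at this

theorem isBot_iff_isEmptyObject {X : C} {b : Subobject X} : IsBot b ↔ IsEmptyObject (b : C) := by
  constructor
  · intro h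
    have := isBot_pullback b.arrow h
    rwa [pullback_arrow_self] at this
  · intro h S
    have h1 : (Subobject.pullback b.arrow).obj S = ⊤ := top_le_iff.1 (h _)
    have : IsIso ((Subobject.pullback b.arrow).obj S).arrow :=
      (Subobject.isIso_arrow_iff_eq_top _).2 h1
    refine Subobject.le_of_comm
      (inv ((Subobject.pullback b.arrow).obj S).arrow ≫ Subobject.pullbackπ b.arrow S) ?_
    rw [Category.assoc, (Subobject.isPullback b.arrow S).w, IsIso.inv_hom_id_assoc]

/-- A nonempty object is not covered by two subobjects with empty domains. -/
theorem IsEmptyObject.of_isLUB {A : C} {a b : Subobject A} (h : IsLUB {a, b} ⊤)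
    (ha : IsEmptyObject (a : C)) (hb : IsEmptyObject (b : C)) : IsEmptyObject A := by
  intro S
  refine h.2 ?_
  rintro x (rfl | rfl)
  exacts [isBot_iff_isEmptyObject.2 ha S, isBot_iff_isEmptyObject.2 hb S]

end Coherent

/-! ### Named conditions -/

section Conditions

/-- Names for the elements of a model under construction. The data of a name
encode a finite diagram together with a morphism `f : V ⟶ A` whose codomain is the object of the
diagram; the name stands for an element of sort `V` chosen above a given element of `A`. -/
inductive Name (C : Type u) [SmallCategory C] : Type u
  | mk (V A : C) (f : V ⟶ A) (n : ℕ) (v : Fin n → Name C) (a : Fin n → Arrow C) : Name C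

/-- The object of which a name denotes an element. -/
def Name.sort {C : Type u} [SmallCategory C] : Name C → C
  | .mk V _ _ _ _ _ => V

/-- A condition: an object presented as a relation between finitely many named elements, i.e.
with a jointly monic family of morphisms to the sorts of finitely many names. -/
structure Condition (C : Type u) [SmallCategory C] where
  /-- The underlying object. -/
  obj : C
  /-- The names which the condition mentions. -/
  names : Finset (Name C)
  /-- The projections to the sorts of the names. -/
  value (v : Name C) (hv : v ∈ names) : obj ⟶ v.sort
  hom_ext {Z : C} (f g : Z ⟶ obj) (h : ∀ v hv, f ≫ value v hv = g ≫ value v hv) : f = g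

namespace Condition

variable {C : Type u} [SmallCategory C]

/-- `r ≤ q` if `r` mentions all names of `q` and entails the relation `q` between them. -/
instance : Preorder (Condition C) where
  le r q := ∃ h : r.obj ⟶ q.obj, ∀ v hv, ∃ hv', h ≫ q.value v hv = r.value v hv'
  le_refl q := ⟨𝟙 _, fun v hv => ⟨hv, Category.id_comp _⟩⟩
  le_trans r q s := by
    rintro ⟨h, hh⟩ ⟨k, hk⟩
    refine ⟨h ≫ k, fun v hv => ?_⟩
    obtain ⟨h1, e1⟩ := hk v hv
    obtain ⟨h2, e2⟩ := hh v h1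
    exact ⟨h2, by rw [Category.assoc, e1, e2]⟩

theorem names_subset {r q : Condition C} (h : r ≤ q) : q.names ⊆ r.names := fun v hv =>
  (h.choose_spec v hv).1

/-- The comparison morphism of an inequality between conditions. -/
noncomputable def homOf {r q : Condition C} (h : r ≤ q) : r.obj ⟶ q.obj := h.choose

theorem homOf_value {r q : Condition C} (h : r ≤ q) (v : Name C) (hv : v ∈ q.names) :
    homOf h ≫ q.value v hv = r.value v (names_subset h hv) := (h.choose_spec v hv).2

variable (C) in
/-- The objects underlying conditions, as a functor. -/
noncomputable def objFunctor : Condition C ⥤ C where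
  obj := obj
  map f := homOf (leOfHom f)
  map_id q := q.hom_ext _ _ fun v hv => by rw [homOf_value, Category.id_comp]
  map_comp f g := hom_ext _ _ _ fun v hv => by
    rw [homOf_value, Category.assoc, homOf_value, homOf_value]

section Meet

variable [HasFiniteLimits C]

instance (r q : Condition C) : Finite {v : Name C // v ∈ r.names ∧ v ∈ q.names} :=
  Finite.of_injective (fun v => (⟨v.1, v.2.1⟩ : r.names)) fun _ _ h =>
    Subtype.ext (by simpa using h)

/-- The product of the sorts of the common names of `r` and `q`. -/
noncomputable abbrev common (r q : Condition C) : C :=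
  ∏ᶜ fun v : {v : Name C // v ∈ r.names ∧ v ∈ q.names} => v.1.sort

/-- On the pullback over the common names, both conditions give these names the same values. -/
theorem pullback_fst_value (r q : Condition C) (v : Name C) (hr : v ∈ r.names)
    (hq : v ∈ q.names) :
    pullback.fst (Pi.lift fun v => r.value v.1 v.2.1 : r.obj ⟶ common r q)
        (Pi.lift fun v => q.value v.1 v.2.2) ≫ r.value v hr =
      pullback.snd _ _ ≫ q.value v hq := by
  have c := pullback.condition (f := (Pi.lift fun v => r.value v.1 v.2.1 : r.obj ⟶ common r q))
    (g := Pi.lift fun v => q.value v.1 v.2.2) =≫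
      Pi.π (fun v : {v : Name C // v ∈ r.names ∧ v ∈ q.names} => v.1.sort) ⟨v, hr, hq⟩
  simpa only [Category.assoc, Pi.lift_π] using c

open scoped Classical in
/-- The conjunction of two conditions: the pullback over the common names. -/
noncomputable def meet (r q : Condition C) : Condition C where
  obj := pullback (Pi.lift fun v => r.value v.1 v.2.1 : r.obj ⟶ common r q)
    (Pi.lift fun v => q.value v.1 v.2.2)
  names := r.names ∪ q.names
  value v hv := if h : v ∈ r.names then pullback.fst _ _ ≫ r.value v h
    else pullback.snd _ _ ≫ q.value v ((Finset.mem_union.1 hv).resolve_left h)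
  hom_ext {Z} f g H := by
    have H1 : ∀ v hv, (f ≫ pullback.fst _ _) ≫ r.value v hv
        = (g ≫ pullback.fst _ _) ≫ r.value v hv := fun v hv => by
      simpa [hv] using H v (Finset.mem_union_left _ hv)
    have e1 := r.hom_ext _ _ H1
    refine pullback.hom_ext e1 (q.hom_ext _ _ fun v hv => ?_)
    by_cases h : v ∈ r.names
    · rw [Category.assoc, Category.assoc, ← pullback_fst_value r q v h hv,
        ← Category.assoc, e1, Category.assoc]
    · simpa [h] using H v (Finset.mem_union_right _ hv)

theorem meet_names (r q : Condition C) {v : Name C} (h : v ∈ (meet r q).names) :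
    v ∈ r.names ∨ v ∈ q.names := by
  classical exact Finset.mem_union.1 h

theorem meet_le_left (r q : Condition C) : meet r q ≤ r := by
  classical
  exact ⟨pullback.fst _ _, fun v hv => ⟨Finset.mem_union_left _ hv, by simp [meet, hv]⟩⟩

theorem meet_le_right (r q : Condition C) : meet r q ≤ q := by
  classical
  refine ⟨pullback.snd _ _, fun v hv => ⟨Finset.mem_union_right _ hv, ?_⟩⟩
  by_cases h : v ∈ r.names
  · simp only [meet, h, dite_true]
    exact (pullback_fst_value r q v h hv).symm
  · simp [meet, h]

/-- A morphism to the object of a conjunction from compatible morphisms to the conjuncts. -/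
noncomputable def meetLift {r q : Condition C} {B : C} (x : B ⟶ r.obj) (y : B ⟶ q.obj)
    (h : ∀ v hr hq, x ≫ r.value v hr = y ≫ q.value v hq) : B ⟶ (meet r q).obj :=
  pullback.lift x y (Pi.hom_ext _ _ fun v => by simpa using h v.1 v.2.1 v.2.2)

theorem le_meet {s r q : Condition C} (h1 : s ≤ r) (h2 : s ≤ q) : s ≤ meet r q := by
  classical
  refine ⟨meetLift (homOf h1) (homOf h2) fun v hr hq => by
    rw [homOf_value, homOf_value], fun v hv => ?_⟩
  by_cases h : v ∈ r.names
  · refine ⟨names_subset h1 h, ?_⟩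
    simp only [meet, h, dite_true]
    exact (pullback.lift_fst_assoc _ _ _ _).trans (homOf_value h1 v h)
  · have hq := (Finset.mem_union.1 hv).resolve_left h
    refine ⟨names_subset h2 hq, ?_⟩
    simp only [meet, h, dite_false]
    exact (pullback.lift_snd_assoc _ _ _ _).trans (homOf_value h2 v hq)

theorem meet_mono {r r' q q' : Condition C} (h : r ≤ r') (h' : q ≤ q') : meet r q ≤ meet r' q' :=
  le_meet ((meet_le_left _ _).trans h) ((meet_le_right _ _).trans h')

end Meet

/-- The restriction of a condition along a monomorphism. -/
def restrict (q : Condition C) {A : C} (i : A ⟶ q.obj) [Mono i] : Condition C where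
  obj := A
  names := q.names
  value v hv := i ≫ q.value v hv
  hom_ext f g h := by
    rw [← cancel_mono i]
    exact q.hom_ext _ _ fun v hv => by simpa using h v hv

theorem restrict_le (q : Condition C) {A : C} (i : A ⟶ q.obj) [Mono i] : q.restrict i ≤ q :=
  ⟨i, fun _ hv => ⟨hv, rfl⟩⟩

/-- The condition without names given by a subterminal object. -/
def ofSubterminal (A : C) (h : ∀ {Z : C} (f g : Z ⟶ A), f = g) : Condition C where
  obj := A
  names := ∅
  value v hv := absurd hv (Finset.notMem_empty v)
  hom_ext f g _ := h f g

/-- A lifting problem: a condition and a morphism to its object. -/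
abbrev LiftingProblem (C : Type u) [SmallCategory C] := Σ (q : Condition C) (V : C), V ⟶ q.obj

/-- The name reserved for a solution of a lifting problem. Its code lists the names and values of
the condition in a chosen order, so that it determines the lifting problem. -/
noncomputable def LiftingProblem.name (t : LiftingProblem C) : Name C :=
  .mk t.2.1 t.1.obj t.2.2 t.1.names.card (fun i => (t.1.names.equivFin.symm i).1)
    (fun i => Arrow.mk (t.1.value _ (t.1.names.equivFin.symm i).2))

theorem LiftingProblem.name_injective : Function.Injective (LiftingProblem.name (C := C)) := by
  have aux : ∀ {α : Type u} {n m : ℕ} (h : n = m) {v : Fin n → α} {w : Fin m → α},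
      HEq v w → ∀ i, v i = w (Fin.cast h i) := by
    rintro α n _ rfl v w h i
    rw [eq_of_heq h]; rfl
  rintro ⟨⟨A, s, a, ha⟩, V, f⟩ ⟨⟨A', s', a', ha'⟩, V', f'⟩ h
  simp only [LiftingProblem.name, Name.mk.injEq] at h
  obtain ⟨rfl, rfl, hf, hn, hv, hw⟩ := h
  obtain rfl := eq_of_heq hf
  have hv := aux hn hv
  have hw := aux hn hw
  obtain rfl : s = s' := by
    ext x
    constructor
    · intro hx
      have := hv (s.equivFin ⟨x, hx⟩)
      rw [Equiv.symm_apply_apply] at this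
      rw [show x = _ from this]
      exact Subtype.prop _
    · intro hx
      have := hv (Fin.cast hn.symm (s'.equivFin ⟨x, hx⟩))
      rw [show Fin.cast hn (Fin.cast hn.symm (s'.equivFin ⟨x, hx⟩)) = s'.equivFin ⟨x, hx⟩ from rfl,
        Equiv.symm_apply_apply] at this
      rw [← show _ = x from this]
      exact Subtype.prop _
  obtain rfl : a = a' := by
    funext x hx
    have := hw (s.equivFin ⟨x, hx⟩)
    rw [show Fin.cast hn (s.equivFin ⟨x, hx⟩) = s.equivFin ⟨x, hx⟩ from rfl] at this
    have key : ∀ y : s, Arrow.mk (a y.1 y.2) = Arrow.mk (a' y.1 y.2) →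
      a y.1 y.2 = a' y.1 y.2 := fun y hy => Arrow.mk_injective _ _ hy
    have := key _ this
    rw [Equiv.symm_apply_apply] at this
    exact this
  rfl

/-- A condition solves a lifting problem if it entails the existence of a lift. -/
def Solves (r : Condition C) (t : LiftingProblem C) : Prop :=
  ∃ h : r.obj ⟶ t.2.1, ∀ v hv, ∃ hv', h ≫ t.2.2 ≫ t.1.value v hv = r.value v hv'

theorem Solves.le {r : Condition C} {t : LiftingProblem C} (h : r.Solves t) : r ≤ t.1 :=
  ⟨h.choose ≫ t.2.2, fun v hv => by simpa using h.choose_spec v hv⟩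

@[simp]
theorem LiftingProblem.name_sort (t : LiftingProblem C) : t.name.sort = t.2.1 := rfl

open scoped Classical in
/-- The generic solution of a lifting problem `V ⟶ q.obj`: the object `V`, with its reserved name
denoting the generic element of `V`. The reserved name takes precedence over a name of `q`, so that
this is an extension of `q` only if `q` does not mention the reserved name. -/
noncomputable def solution (t : LiftingProblem C) : Condition C where
  obj := t.2.1
  names := insert t.name t.1.names
  value v hv := if h : v = t.name then eqToHom (by rw [h, LiftingProblem.name_sort])
    else t.2.2 ≫ t.1.value v (Finset.mem_of_mem_insert_of_ne hv h)
  hom_ext f g H := by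
    have := H t.name (Finset.mem_insert_self _ _)
    simp only [dite_true] at this
    rwa [cancel_mono] at this

theorem solution_names (t : LiftingProblem C) {v : Name C} (hv : v ∈ (solution t).names) :
    v = t.name ∨ v ∈ t.1.names := by
  classical exact Finset.mem_insert.1 hv

theorem solution_value (t : LiftingProblem C) {v : Name C} (hv : v ∈ t.1.names) (h : v ≠ t.name) :
    ∃ hv', (solution t).value v hv' = t.2.2 ≫ t.1.value v hv := by
  classical exact ⟨Finset.mem_insert_of_mem hv, by simp [solution, h]⟩

theorem solution_solves (t : LiftingProblem C) (h : t.name ∉ t.1.names) :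
    (solution t).Solves t := by
  refine ⟨𝟙 t.2.1, fun v hv => ?_⟩
  obtain ⟨hv', e⟩ := solution_value t hv (fun e => h (e ▸ hv))
  exact ⟨hv', (Category.id_comp _).trans e.symm⟩

end Condition
end Conditions

/-! ### Generic filters of conditions -/

section Generic

variable {C : Type u} [SmallCategory C] [CoherentCategory C]

open Condition

/-- A consistent filter of conditions. The last clause says that the name reserved for a lifting
problem is mentioned only if the problem is solved: it keeps the names of unsolved problems
fresh. -/
structure IsConsistentFilter (P : Set (Condition C)) : Prop where
  mem_of_le {q r : Condition C} : q ∈ P → q ≤ r → r ∈ P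
  meet_mem {q r : Condition C} : q ∈ P → r ∈ P → meet q r ∈ P
  not_isEmpty {q : Condition C} : q ∈ P → ¬ IsEmptyObject q.obj
  solved {q : Condition C} : q ∈ P → ∀ t : LiftingProblem C, t.name ∈ q.names →
    ∃ r ∈ P, r.Solves t

/-- The filter generated by a filter `P` and a condition `q`. -/
def adjoinCondition (P : Set (Condition C)) (q : Condition C) : Set (Condition C) :=
  {t | ∃ r ∈ P, meet r q ≤ t}

theorem subset_adjoinCondition (P : Set (Condition C)) (q : Condition C) :
    P ⊆ adjoinCondition P q :=
  fun r hr => ⟨r, hr, meet_le_left r q⟩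

theorem mem_adjoinCondition {P : Set (Condition C)} {r : Condition C} (hr : r ∈ P)
    (q : Condition C) : q ∈ adjoinCondition P q :=
  ⟨r, hr, meet_le_right r q⟩

theorem IsConsistentFilter.adjoin {P : Set (Condition C)} (hP : IsConsistentFilter P)
    {q : Condition C} (hq : ∀ r ∈ P, ¬ IsEmptyObject (meet r q).obj)
    (hs : ∀ t : LiftingProblem C, t.name ∈ q.names → ∃ r ∈ adjoinCondition P q, r.Solves t) :
    IsConsistentFilter (adjoinCondition P q) where
  mem_of_le := by
    rintro s t ⟨r, hr, hrs⟩ hst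
    exact ⟨r, hr, hrs.trans hst⟩
  meet_mem := by
    rintro s t ⟨r, hr, hrs⟩ ⟨r', hr', hrt⟩
    exact ⟨meet r r', hP.meet_mem hr hr', le_meet
      ((meet_mono (meet_le_left _ _) le_rfl).trans hrs)
      ((meet_mono (meet_le_right _ _) le_rfl).trans hrt)⟩
  not_isEmpty := by
    rintro s ⟨r, hr, hrs⟩ h
    exact hq r hr (h.of_hom (homOf hrs))
  solved := by
    rintro s ⟨r, hr, hrs⟩ t ht
    rcases meet_names _ _ (names_subset hrs ht) with h | h
    · obtain ⟨r', hr', h'⟩ := hP.solved hr t h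
      exact ⟨r', subset_adjoinCondition P q hr', h'⟩
    · exact hs t h

theorem exists_maximal_isConsistentFilter {P₀ : Set (Condition C)} (h₀ : IsConsistentFilter P₀) :
    ∃ P, P₀ ⊆ P ∧ Maximal IsConsistentFilter P := by
  refine zorn_subset_nonempty {P | IsConsistentFilter P} (fun c hc hchain hne => ?_) P₀ h₀
  refine ⟨⋃₀ c, ?_, fun s hs => Set.subset_sUnion_of_mem hs⟩
  refine ⟨?_, ?_, ?_, ?_⟩
  · rintro q r ⟨P, hP, hq⟩ hqr
    exact ⟨P, hP, (hc hP).mem_of_le hq hqr⟩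
  · rintro q r ⟨P, hP, hq⟩ ⟨P', hP', hr⟩
    rcases hchain.total hP hP' with h | h
    · exact ⟨P', hP', (hc hP').meet_mem (h hq) hr⟩
    · exact ⟨P, hP, (hc hP).meet_mem hq (h hr)⟩
  · rintro q ⟨P, hP, hq⟩
    exact (hc hP).not_isEmpty hq
  · rintro q ⟨P, hP, hq⟩ t ht
    obtain ⟨r, hr, h⟩ := (hc hP).solved hq t ht
    exact ⟨r, ⟨P, hP, hr⟩, h⟩

theorem IsConsistentFilter.mem_of_maximal {P : Set (Condition C)}
    (hP : Maximal IsConsistentFilter P) {q r : Condition C} (hr : r ∈ P)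
    (h : IsConsistentFilter (adjoinCondition P q)) : q ∈ P :=
  hP.2 h (subset_adjoinCondition P q) (mem_adjoinCondition hr q)

/-- A maximal consistent filter solves every lifting problem along a regular epimorphism: if the
reserved name is still fresh, then the generic solution is consistent with the filter. -/
theorem exists_solves_of_maximal {P : Set (Condition C)} (hP : Maximal IsConsistentFilter P)
    (t : LiftingProblem C) (ht : t.1 ∈ P) [IsRegularEpi t.2.2] : ∃ r ∈ P, r.Solves t := by
  by_cases hfresh : ∃ r ∈ P, t.name ∈ r.names
  · obtain ⟨r, hr, h⟩ := hfresh
    exact hP.1.solved hr t h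
  push Not at hfresh
  have hsol := solution_solves t (hfresh _ ht)
  refine ⟨solution t, IsConsistentFilter.mem_of_maximal hP ht (hP.1.adjoin ?_ ?_), hsol⟩
  · intro r hr hempty
    have hm := hP.1.meet_mem hr ht
    have h1 := meet_le_left r t.1
    have h2 := meet_le_right r t.1
    -- the pullback of `t` to `meet r t.1` covers this nonempty object and maps to the conjunction
    -- of `r` and the generic solution, because `r` does not mention the reserved name
    refine hP.1.not_isEmpty hm (IsEmptyObject.of_isRegularEpi (hempty.of_hom
      (meetLift (pullback.fst (homOf h2) t.2.2 ≫ homOf h1) (pullback.snd (homOf h2) t.2.2) ?_))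
      (pullback.fst (homOf h2) t.2.2))
    intro v hvr hv
    have hne : v ≠ t.name := fun e => hfresh r hr (e ▸ hvr)
    have hvt := (solution_names t hv).resolve_left hne
    obtain ⟨hv', e⟩ := solution_value t hvt hne
    have w := pullback.condition (f := homOf h2) (g := t.2.2) =≫ t.1.value v hvt
    rw [Category.assoc, Category.assoc, homOf_value] at w
    rw [e, Category.assoc, homOf_value]
    exact w
  · intro t' ht'
    rcases solution_names t ht' with h | h
    · obtain rfl := LiftingProblem.name_injective h
      exact ⟨_, mem_adjoinCondition ht _, hsol⟩
    · obtain ⟨r, hr, h'⟩ := hP.1.solved ht t' h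
      exact ⟨r, subset_adjoinCondition P _ hr, h'⟩

/-- A maximal consistent filter is prime. -/
theorem restrict_mem_or_of_maximal {P : Set (Condition C)} (hP : Maximal IsConsistentFilter P)
    {q : Condition C} (hq : q ∈ P) {a b : Subobject q.obj} (hab : IsLUB {a, b} ⊤) :
    q.restrict a.arrow ∈ P ∨ q.restrict b.arrow ∈ P := by
  -- if the restriction of `q` to `d` is not in `P`, then it is inconsistent with some `r` in `P`
  have key : ∀ d : Subobject q.obj, q.restrict d.arrow ∉ P →
      ∃ r ∈ P, ∀ s (_ : s ≤ r) (hsq : s ≤ q),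
        IsEmptyObject ((Subobject.pullback (homOf hsq)).obj d : C) := by
    intro d hd
    by_contra! hcon
    refine hd (IsConsistentFilter.mem_of_maximal hP hq (hP.1.adjoin ?_ ?_))
    · intro r hr hempty
      obtain ⟨s, hsr, hsq, hs⟩ := hcon r hr
      refine hs (hempty.of_hom (meetLift (((Subobject.pullback (homOf hsq)).obj d).arrow ≫
        homOf hsr) (Subobject.pullbackπ (homOf hsq) d) ?_))
      intro v hvr hvq
      have w := (Subobject.isPullback (homOf hsq) d).w =≫ q.value v hvq
      rw [Category.assoc, Category.assoc, homOf_value hsq v hvq] at w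
      rw [Category.assoc, homOf_value]
      exact w.symm
    · intro t ht
      obtain ⟨r, hr, h⟩ := hP.1.solved hq t ht
      exact ⟨r, subset_adjoinCondition P _ hr, h⟩
  by_contra! hcon
  obtain ⟨r, hr, h1⟩ := key a hcon.1
  obtain ⟨r', hr', h2⟩ := key b hcon.2
  have hm := hP.1.meet_mem (hP.1.meet_mem hr hr') hq
  have hle := meet_le_left (meet r r') q
  have hlub := isLUB_pullback (homOf (meet_le_right (meet r r') q)) hab
  rw [Subobject.pullback_top] at hlub
  exact hP.1.not_isEmpty hm (IsEmptyObject.of_isLUB hlub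
    (h1 _ (hle.trans (meet_le_left _ _)) _) (h2 _ (hle.trans (meet_le_right _ _)) _))

end Generic

/-! ### Set-valued models -/

section Model

variable {C : Type u} [SmallCategory C]

open Condition

/-- A set-valued model of a coherent category, i.e. a coherent functor to sets, in terms of
elements. -/
structure IsSetModel (N : C ⥤ Type u) : Prop where
  preservesFiniteLimits : PreservesFiniteLimits N
  surjective {X Y : C} (f : X ⟶ Y) : IsRegularEpi f → Function.Surjective (N.map f)
  isEmpty {X : C} (b : Subobject X) : IsBot b → IsEmpty (N.obj (b : C))
  exists_of_isLUB {X : C} {a b c : Subobject X} : IsLUB {a, b} c → ∀ z : N.obj (c : C),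
    (∃ y, N.map a.arrow y = N.map c.arrow z) ∨ (∃ y, N.map b.arrow y = N.map c.arrow z)

/-- The functor pro-represented by a set of conditions. -/
noncomputable def proRepresented (P : Set (Condition C)) : C ⥤ Type u :=
  yoneda ⋙ (Functor.whiskeringLeft _ _ _).obj
    (ObjectProperty.ι (fun q => q ∈ P) ⋙ objFunctor C).op ⋙ colim

variable {P : Set (Condition C)}

/-- The element represented by a morphism out of a condition. -/
noncomputable def proElement {q : Condition C} (hq : q ∈ P) {X : C} (f : q.obj ⟶ X) :
    (proRepresented P).obj X :=
  colimit.ι ((ObjectProperty.ι (fun q => q ∈ P) ⋙ objFunctor C).op ⋙ yoneda.obj X)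
    (Opposite.op ⟨q, hq⟩) f

theorem proRepresented_map {q : Condition C} (hq : q ∈ P) {X Y : C} (f : q.obj ⟶ X) (g : X ⟶ Y) :
    (proRepresented P).map g (proElement hq f) = proElement hq (f ≫ g) :=
  ConcreteCategory.congr_hom (ι_colimMap (Functor.whiskerLeft
    (ObjectProperty.ι (fun q => q ∈ P) ⋙ objFunctor C).op (yoneda.map g))
    (Opposite.op ⟨q, hq⟩)) f

theorem proElement_restrict {q r : Condition C} (hq : q ∈ P) (hr : r ∈ P) (h : r ≤ q) {X : C}
    (f : q.obj ⟶ X) : proElement hq f = proElement hr (homOf h ≫ f) :=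
  (ConcreteCategory.congr_hom (colimit.w
    ((ObjectProperty.ι (fun q => q ∈ P) ⋙ objFunctor C).op ⋙ yoneda.obj X)
    (Quiver.Hom.op (ObjectProperty.homMk (homOfLE h) :
      (⟨r, hr⟩ : ObjectProperty.FullSubcategory (fun q => q ∈ P)) ⟶ ⟨q, hq⟩))) f).symm

theorem exists_proElement {X : C} (x : (proRepresented P).obj X) :
    ∃ (q : Condition C) (hq : q ∈ P) (f : q.obj ⟶ X), x = proElement hq f := by
  obtain ⟨j, f, h⟩ := Types.jointly_surjective'
    (F := (ObjectProperty.ι (fun q => q ∈ P) ⋙ objFunctor C).op ⋙ yoneda.obj X) x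
  exact ⟨j.unop.1, j.unop.2, f, h.symm⟩

theorem IsConsistentFilter.preservesFiniteLimits [CoherentCategory C] (hP : IsConsistentFilter P)
    (hne : P.Nonempty) :
    PreservesFiniteLimits (proRepresented P) := by
  have : Nonempty (ObjectProperty.FullSubcategory (fun q => q ∈ P)) := ⟨⟨_, hne.some_mem⟩⟩
  have : IsCofiltered (ObjectProperty.FullSubcategory (fun q => q ∈ P)) :=
    { cone_objs q r := ⟨⟨_, hP.meet_mem q.2 r.2⟩,
        ObjectProperty.homMk (homOfLE (meet_le_left _ _)),
        ObjectProperty.homMk (homOfLE (meet_le_right _ _)), trivial⟩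
      cone_maps q r f g := ⟨q, 𝟙 _, by congr 1; ext; exact Subsingleton.elim _ _⟩ }
  unfold proRepresented
  infer_instance

/-- The functor pro-represented by a maximal consistent filter is a model. -/
theorem isSetModel_of_maximal [CoherentCategory C] (hP : Maximal IsConsistentFilter P)
    (hne : P.Nonempty) :
    IsSetModel (proRepresented P) where
  preservesFiniteLimits := hP.1.preservesFiniteLimits hne
  surjective {X Y} f hf y := by
    obtain ⟨q, hq, g, rfl⟩ := exists_proElement y
    obtain ⟨r, hr, hsol⟩ := exists_solves_of_maximal hP ⟨q, _, pullback.fst g f⟩ hq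
    have hle : r ≤ q := hsol.le
    obtain ⟨h, hh⟩ := hsol
    refine ⟨proElement hr (h ≫ pullback.snd g f), ?_⟩
    have e : h ≫ pullback.fst g f = homOf hle := q.hom_ext _ _ fun v hv => by
      rw [homOf_value, Category.assoc, (hh v hv).choose_spec]
    rw [proRepresented_map, proElement_restrict hq hr hle, ← e, Category.assoc, Category.assoc,
      pullback.condition]
  isEmpty {X} b hb := by
    refine ⟨fun z => ?_⟩
    obtain ⟨q, hq, g, rfl⟩ := exists_proElement z
    exact hP.1.not_isEmpty hq ((isBot_iff_isEmptyObject.1 hb).of_hom g)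
  exists_of_isLUB {X} a b c h z := by
    obtain ⟨q, hq, g, rfl⟩ := exists_proElement z
    have hlub := isLUB_pullback (g ≫ c.arrow) h
    have htop : (Subobject.pullback (g ≫ c.arrow)).obj c = ⊤ := by
      rw [Subobject.pullback_comp, pullback_arrow_self, Subobject.pullback_top]
    rw [htop] at hlub
    have key : ∀ d : Subobject X,
        q.restrict ((Subobject.pullback (g ≫ c.arrow)).obj d).arrow ∈ P →
        ∃ y, (proRepresented P).map d.arrow y =
          (proRepresented P).map c.arrow (proElement hq g) := by
      intro d hd
      refine ⟨proElement hd (Subobject.pullbackπ (g ≫ c.arrow) d), ?_⟩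
      have hle := q.restrict_le ((Subobject.pullback (g ≫ c.arrow)).obj d).arrow
      have e : homOf hle = ((Subobject.pullback (g ≫ c.arrow)).obj d).arrow :=
        q.hom_ext _ _ fun v hv => homOf_value hle v hv
      rw [proRepresented_map hq, proElement_restrict hq hd hle, e]
      exact (proRepresented_map hd _ _).trans
        (congrArg (proElement hd) (Subobject.isPullback (g ≫ c.arrow) d).w)
    exact (restrict_mem_or_of_maximal hP hq hlub).imp (key a) (key b)

/-- Completeness of coherent logic: every proper filter of subterminal objects is realized by a
set-valued model. -/
theorem exists_isSetModel [CoherentCategory C] (U : Set (Subobject (⊤_ C))) (htop : ⊤ ∈ U)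
    (hinf : ∀ a ∈ U, ∀ b ∈ U, a ⊓ b ∈ U) (hbot : ∀ a ∈ U, ¬ IsBot a) :
    ∃ N : C ⥤ Type u, IsSetModel N ∧ ∀ a ∈ U, Nonempty (N.obj (a : C)) := by
  let c : Subobject (⊤_ C) → Condition C := fun a => ofSubterminal (a : C) fun f g => by
    rw [← cancel_mono a.arrow]
    exact Subsingleton.elim _ _
  have hc : ∀ {a b}, a ≤ b → c a ≤ c b := fun {a b} h =>
    ⟨Subobject.ofLE a b h, fun v hv => absurd hv (Finset.notMem_empty v)⟩
  have h₀ : IsConsistentFilter {t | ∃ a ∈ U, c a ≤ t} :=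
    { mem_of_le := by
        rintro s t ⟨a, ha, has⟩ hst
        exact ⟨a, ha, has.trans hst⟩
      meet_mem := by
        rintro s t ⟨a, ha, has⟩ ⟨b, hb, hbt⟩
        exact ⟨a ⊓ b, hinf a ha b hb, le_meet ((hc inf_le_left).trans has)
          ((hc inf_le_right).trans hbt)⟩
      not_isEmpty := by
        rintro s ⟨a, ha, has⟩ h
        exact hbot a ha (isBot_iff_isEmptyObject.2 (h.of_hom (homOf has)))
      solved := by
        rintro s ⟨a, ha, has⟩ t ht
        exact absurd (names_subset has ht) (Finset.notMem_empty _) }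
  obtain ⟨P, hP, hmax⟩ := exists_maximal_isConsistentFilter h₀
  refine ⟨proRepresented P, isSetModel_of_maximal hmax ⟨c ⊤, hP ⟨⊤, htop, le_rfl⟩⟩,
    fun a ha => ⟨proElement (hP ⟨a, ha, le_rfl⟩) (𝟙 (a : C))⟩⟩

end Model

/-! ### A retraction of the power set of the Stone space -/

section Stone

/-- The points of the Stone space of `B`, as prime ideals. -/
abbrev StonePoint (B : Type u) [Lattice B] : Type u := {I : Order.Ideal B // I.IsPrime}

variable {B : Type u} [CompleteBooleanAlgebra B]

/-- The clopen set of the Stone space given by an element of `B`. -/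
def stoneSet (b : B) : Set (StonePoint B) := {x | b ∉ x.1}

theorem mem_stoneSet {b : B} {x : StonePoint B} : x ∈ stoneSet b ↔ b ∉ x.1 := Iff.rfl

theorem mem_stoneSet_inf {a b : B} {x : StonePoint B} :
    x ∈ stoneSet (a ⊓ b) ↔ x ∈ stoneSet a ∧ x ∈ stoneSet b := by
  simp only [mem_stoneSet]
  have := x.2
  constructor
  · exact fun h => ⟨fun ha => h (x.1.lower inf_le_left ha), fun hb => h (x.1.lower inf_le_right hb)⟩
  · rintro ⟨ha, hb⟩ h
    exact (x.2.mem_or_mem h).elim ha hb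

theorem mem_stoneSet_compl {b : B} {x : StonePoint B} : x ∈ stoneSet bᶜ ↔ x ∉ stoneSet b := by
  simp only [mem_stoneSet, not_not]
  have := x.2
  constructor
  · exact fun h => x.2.mem_or_compl_mem.resolve_right h
  · exact fun h h' => Order.Ideal.IsProper.notMem_of_compl_mem this.toIsProper h' h

theorem mem_stoneSet_sup {a b : B} {x : StonePoint B} :
    x ∈ stoneSet (a ⊔ b) ↔ x ∈ stoneSet a ∨ x ∈ stoneSet b := by
  simp only [mem_stoneSet, Order.Ideal.sup_mem_iff]
  tauto

theorem mem_stoneSet_of_le {a b : B} (h : a ≤ b) {x : StonePoint B} (hx : x ∈ stoneSet a) :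
    x ∈ stoneSet b := fun hb => hx (x.1.lower h hb)

theorem mem_stoneSet_top (x : StonePoint B) : x ∈ stoneSet (⊤ : B) :=
  have := x.2
  Order.Ideal.IsProper.top_notMem this.toIsProper

theorem notMem_stoneSet_bot (x : StonePoint B) : x ∉ stoneSet (⊥ : B) :=
  fun h => h x.1.bot_mem

theorem exists_mem_stoneSet_of_mem_stoneSet_sup {s : Finset B} {x : StonePoint B}
    (h : x ∈ stoneSet (s.sup id)) : ∃ a ∈ s, x ∈ stoneSet a := by
  classical
  induction s using Finset.induction_on with
  | empty => exact absurd h (notMem_stoneSet_bot x)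
  | insert a s _ ih =>
    rw [Finset.sup_insert, id, mem_stoneSet_sup] at h
    rcases h with h | h
    · exact ⟨a, Finset.mem_insert_self _ _, h⟩
    · obtain ⟨b, hb, hx⟩ := ih h
      exact ⟨b, Finset.mem_insert_of_mem hb, hx⟩

theorem eq_top_of_forall_mem_stoneSet {b : B} (h : ∀ x, x ∈ stoneSet b) : b = ⊤ := by
  by_contra hb
  obtain ⟨J, hJ, hle, -⟩ := DistribLattice.prime_ideal_of_disjoint_filter_ideal
    (F := Order.PFilter.principal (⊤ : B)) (I := Order.Ideal.principal b) (by
      rw [Set.disjoint_left]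
      intro a ha ha'
      simp only [SetLike.mem_coe, Order.PFilter.mem_principal, top_le_iff] at ha
      subst ha
      exact hb (top_le_iff.1 ha'))
  exact h ⟨J, hJ⟩ (hle (Order.Ideal.mem_principal_self))

/-- A filter on the Stone space modulo which distinct elements of `B` stay distinct. -/
def IsSeparating (G : Filter (StonePoint B)) : Prop := ∀ b : B, stoneSet b ∈ G → b = ⊤

theorem exists_minimal_isSeparating : ∃ G : Filter (StonePoint B), Minimal IsSeparating G := by
  obtain ⟨m, hm⟩ := zorn_le₀ (α := (Filter (StonePoint B))ᵒᵈ)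
    {G | IsSeparating (OrderDual.ofDual G)} fun c hc hchain => by
      rcases c.eq_empty_or_nonempty with rfl | hne
      · refine ⟨OrderDual.toDual ⊤, fun b hb => ?_, by simp⟩
        exact eq_top_of_forall_mem_stoneSet fun x => (Filter.mem_top.1 hb).symm ▸ Set.mem_univ x
      · refine ⟨OrderDual.toDual (⨅ G ∈ c, OrderDual.ofDual G), fun b hb => ?_, fun G hG => ?_⟩
        · obtain ⟨G, hG, hb⟩ := (Filter.mem_biInf_of_directed (fun G hG G' hG' => by
            rcases hchain.total hG hG' with h | h
            · exact ⟨G', hG', h, le_rfl⟩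
            · exact ⟨G, hG, le_rfl, h⟩) hne).1 hb
          exact hc hG b hb
        · exact iInf₂_le (f := fun (G : (Filter (StonePoint B))ᵒᵈ) (_ : G ∈ c) =>
            OrderDual.ofDual G) G hG
  exact ⟨OrderDual.ofDual m, hm.1, fun G hG h => hm.2 (y := OrderDual.toDual G) hG h⟩

/-- Modulo a minimal separating filter, every set of points is represented by an element of `B`.
Thus `B` is a retract of the power set of its Stone space; this is where completeness of `B` is
used. -/
theorem exists_eventually_iff_mem_stoneSet {G : Filter (StonePoint B)}
    (hG : Minimal IsSeparating G) (A : Set (StonePoint B)) :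
    ∃ b : B, ∀ᶠ x in G, x ∈ A ↔ x ∈ stoneSet b := by
  have le_of : ∀ {a b : B}, (∀ᶠ x in G, x ∈ stoneSet a → x ∈ stoneSet b) → a ≤ b := by
    intro a b h
    have := hG.1 (aᶜ ⊔ b) (by
      filter_upwards [h] with x hx
      rw [mem_stoneSet_sup, mem_stoneSet_compl]
      tauto)
    rwa [sup_comm, ← himp_eq, himp_eq_top_iff] at this
  let L : Set B := {l | ∀ᶠ x in G, x ∈ stoneSet l → x ∈ A}
  let b := sSup L
  refine ⟨b, ?_⟩
  by_contra hcon
  -- adding the desired equivalence to `G` destroys separation at some `c`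
  have hns : ¬ IsSeparating (G ⊓ Filter.principal {x | x ∈ A ↔ x ∈ stoneSet b}) := fun h =>
    hcon (Filter.le_principal_iff.1 ((hG.2 h inf_le_left).trans inf_le_right))
  simp only [IsSeparating, not_forall] at hns
  obtain ⟨c, hc, hne⟩ := hns
  have hc' : ∀ᶠ x in G, (x ∈ A ↔ x ∈ stoneSet b) → x ∈ stoneSet c := Filter.mem_inf_principal.1 hc
  -- outside `c`, the set `A` agrees with the complement of `b`; hence `cᶜ ⊓ bᶜ` lies below `A`
  have h1 : cᶜ ⊓ bᶜ ≤ b := by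
    refine le_sSup (α := B) (show cᶜ ⊓ bᶜ ∈ L from ?_)
    filter_upwards [hc'] with x hx hxl
    rw [mem_stoneSet_inf, mem_stoneSet_compl, mem_stoneSet_compl] at hxl
    tauto
  have h2 : cᶜ ≤ b := by
    have : cᶜ ⊓ bᶜ = ⊥ := le_bot_iff.1 ((le_inf h1 inf_le_right).trans inf_compl_eq_bot.le)
    rwa [← sdiff_eq, sdiff_eq_bot_iff] at this
  -- as `cᶜ ≤ b`, the set `A` is empty outside `c`, so the elements below `A` are below `c`
  have h3 : b ≤ c := by
    refine sSup_le fun l hl => le_of ?_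
    have hl' : ∀ᶠ x in G, x ∈ stoneSet l → x ∈ A := hl
    filter_upwards [hl', hc'] with x hx hxc hxl
    by_contra hn
    have hb := mem_stoneSet_of_le h2 (mem_stoneSet_compl.2 hn)
    exact hn (hxc ⟨fun _ => hb, fun _ => hx hxl⟩)
  refine hne (top_le_iff.1 ?_)
  rw [← sup_compl_eq_top (x := c)]
  exact sup_le le_rfl (h2.trans h3)

end Stone

/-! ### Germs of partial sections along a filter -/

section Germs

variable {S : Type u}

/-- Partial sections of a family of sets which are defined on a set of the filter `F`. -/
def PartialSection (F : Filter S) (N : S → Type u) : Type u :=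
  {f : ∀ x, Option (N x) // ∀ᶠ x in F, (f x).isSome}

/-- Partial sections are equivalent if they eventually agree. -/
instance PartialSection.setoid (F : Filter S) (N : S → Type u) : Setoid (PartialSection F N) where
  r f g := ∀ᶠ x in F, f.1 x = g.1 x
  iseqv :=
    { refl := fun f => Filter.Eventually.of_forall fun x => rfl
      symm := fun h => h.mono fun x hx => hx.symm
      trans := fun h h' => by filter_upwards [h, h'] with x h1 h2 using h1.trans h2 }

/-- The reduced product of a family of possibly empty sets along a filter: germs of partial
sections. -/
def ReducedProduct (F : Filter S) (N : S → Type u) : Type u :=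
  Quotient (PartialSection.setoid F N)

namespace ReducedProduct

variable {F : Filter S} {N N' : S → Type u}

/-- The germ of a partial section. -/
def mk (f : ∀ x, Option (N x)) (hf : ∀ᶠ x in F, (f x).isSome) : ReducedProduct F N :=
  Quotient.mk _ ⟨f, hf⟩

theorem mk_eq_mk {f g : ∀ x, Option (N x)} {hf : ∀ᶠ x in F, (f x).isSome}
    {hg : ∀ᶠ x in F, (g x).isSome} : mk f hf = mk g hg ↔ ∀ᶠ x in F, f x = g x := Quotient.eq

theorem exists_mk (z : ReducedProduct F N) : ∃ f hf, z = mk f hf := by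
  induction z using Quotient.inductionOn with
  | h f => exact ⟨f.1, f.2, rfl⟩

/-- Functoriality of reduced products in the family. -/
def map (φ : ∀ x, N x → N' x) : ReducedProduct F N → ReducedProduct F N' :=
  Quotient.map (fun f => ⟨fun x => (f.1 x).map (φ x), f.2.mono fun x hx => by simpa using hx⟩)
    fun _ _ h => h.mono fun x hx => congrArg (Option.map (φ x)) hx

@[simp]
theorem map_mk (φ : ∀ x, N x → N' x) (f : ∀ x, Option (N x)) (hf : ∀ᶠ x in F, (f x).isSome) :
    map φ (mk f hf) = mk (fun x => (f x).map (φ x)) (hf.mono fun x hx => by simpa using hx) := rfl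

/-- Restriction of germs to a finer filter. -/
def restrict {F' : Filter S} (h : F' ≤ F) : ReducedProduct F N → ReducedProduct F' N :=
  Quotient.map (fun f => ⟨f.1, h f.2⟩) fun _ _ h' => h h'

theorem map_surjective {φ : ∀ x, N x → N' x} (hφ : ∀ x, Function.Surjective (φ x)) :
    Function.Surjective (map (F := F) φ) := by
  intro z
  obtain ⟨f, hf, rfl⟩ := exists_mk z
  choose ψ hψ using hφ
  refine ⟨mk (fun x => (f x).map (ψ x)) (hf.mono fun x hx => by simpa using hx), ?_⟩
  rw [map_mk, mk_eq_mk]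
  refine Filter.Eventually.of_forall fun x => ?_
  cases f x <;> simp [hψ]

theorem subsingleton (hN : ∀ x, Subsingleton (N x)) : Subsingleton (ReducedProduct F N) := by
  refine ⟨fun z w => ?_⟩
  obtain ⟨f, hf, rfl⟩ := exists_mk z
  obtain ⟨g, hg, rfl⟩ := exists_mk w
  rw [mk_eq_mk]
  filter_upwards [hf, hg] with x h1 h2
  obtain ⟨a, ha⟩ := Option.isSome_iff_exists.1 h1
  obtain ⟨b, hb⟩ := Option.isSome_iff_exists.1 h2
  rw [ha, hb, Subsingleton.elim a b]

variable {C : Type u} [SmallCategory C]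

/-- The reduced product of a family of functors. -/
def functor (F : Filter S) (N : S → C ⥤ Type u) : C ⥤ Type u where
  obj X := ReducedProduct F fun x => (N x).obj X
  map f := ↾ map fun x => (N x).map f
  map_id X := by
    ext z
    obtain ⟨f, hf, rfl⟩ := exists_mk z
    refine mk_eq_mk.2 (Filter.Eventually.of_forall fun x => ?_)
    cases h : f x <;> simp [h]
  map_comp f g := by
    ext z
    obtain ⟨f, hf, rfl⟩ := exists_mk z
    refine mk_eq_mk.2 (Filter.Eventually.of_forall fun x => ?_)
    cases h : f x <;> simp [h]

theorem preservesFiniteLimits_functor [HasFiniteLimits C] (F : Filter S) (N : S → C ⥤ Type u)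
    [∀ x, PreservesFiniteLimits (N x)] : PreservesFiniteLimits (functor F N) := by
  have h1 : PreservesLimit (Functor.empty.{0} C) (functor F N) := by
    have hu : ∀ x, Nonempty (Unique ((N x).obj (⊤_ C))) := fun x =>
      ⟨Types.isTerminalEquivUnique _ (IsTerminal.isTerminalObj (N x) _ terminalIsTerminal)⟩
    have := subsingleton (F := F) fun x => (hu x).some.instSubsingleton
    refine preservesLimit_of_preserves_limit_cone terminalIsTerminal ?_
    refine (isLimitMapConeEmptyConeEquiv (functor F N) (⊤_ C)).symm
      ((Types.isTerminalEquivUnique _).symm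
        { default := mk (fun x => some (hu x).some.default) (by simp)
          uniq := fun z => Subsingleton.elim (α := ReducedProduct F _) _ _ })
  have h2 : ∀ {X Y Z : C} (f : X ⟶ Z) (g : Y ⟶ Z), PreservesLimit (cospan f g) (functor F N) := by
    intro X Y Z f g
    rw [(IsPullback.of_hasPullback f g).preservesLimit_cospan_iff]
    have hN := fun x => (IsPullback.of_hasPullback f g).map (N x)
    rw [Types.isPullback_iff]
    refine ⟨by rw [← Functor.map_comp, ← Functor.map_comp, pullback.condition], ?_, ?_⟩
    · intro z w ⟨e1, e2⟩
      obtain ⟨z, hz, rfl⟩ := exists_mk z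
      obtain ⟨w, hw, rfl⟩ := exists_mk w
      replace e1 := mk_eq_mk.1 e1
      replace e2 := mk_eq_mk.1 e2
      refine mk_eq_mk.2 ?_
      filter_upwards [hz, hw, e1, e2] with x h1 h2 h3 h4
      obtain ⟨a, ha⟩ := Option.isSome_iff_exists.1 h1
      obtain ⟨b, hb⟩ := Option.isSome_iff_exists.1 h2
      simp only [ha, hb, Option.map_some, Option.some.injEq] at h3 h4 ⊢
      exact Types.ext_of_isPullback (hN x) h3 h4
    · intro z w e
      obtain ⟨z, hz, rfl⟩ := exists_mk z
      obtain ⟨w, hw, rfl⟩ := exists_mk w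
      replace e := mk_eq_mk.1 e
      have key : ∀ x, ∃ p : Option ((N x).obj (pullback f g)),
          (z x).isSome → (w x).isSome → (z x).map ((N x).map f) = (w x).map ((N x).map g) →
          p.isSome ∧ p.map ((N x).map (pullback.fst f g)) = z x ∧
            p.map ((N x).map (pullback.snd f g)) = w x := by
        intro x
        rcases hzx : z x with _ | a
        · exact ⟨none, by simp⟩
        rcases hwx : w x with _ | b
        · exact ⟨none, by simp⟩
        by_cases hab : (N x).map f a = (N x).map g b
        · obtain ⟨p, h1, h2⟩ := Types.exists_of_isPullback (hN x) a b hab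
          exact ⟨some p, by simp [h1, h2]⟩
        · exact ⟨none, by simp [hab]⟩
      choose p hp using key
      refine ⟨mk p ?_, mk_eq_mk.2 ?_, mk_eq_mk.2 ?_⟩ <;>
      filter_upwards [hz, hw, e] with x h1 h2 h3
      exacts [(hp x h1 h2 h3).1, (hp x h1 h2 h3).2.1, (hp x h1 h2 h3).2.2]
  have : PreservesLimitsOfShape (Discrete.{0} PEmpty) (functor F N) :=
    preservesLimitsOfShape_pempty_of_preservesTerminal _
  have : PreservesLimitsOfShape WalkingCospan (functor F N) :=
    ⟨fun {K} => preservesLimit_of_iso_diagram _ (diagramIsoCospan K).symm⟩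
  exact preservesFiniteLimits_of_preservesTerminal_and_pullbacks _

end ReducedProduct

end Germs

/-! ### Subobjects of sheaves of sets -/

section Sheaves

/-- A morphism of sheaves factors through a monomorphism as soon as its values do so locally. -/
theorem exists_comp_eq_of_locally {D : Type u} [SmallCategory D] {J : GrothendieckTopology D}
    {W Y Z : Sheaf J (Type u)} (f : W ⟶ Y) (m : Z ⟶ Y) [Mono m]
    (h : ∀ (d : D) (s : W.obj.obj (Opposite.op d)), ∃ R ∈ J d, ∀ (e : D) (g : e ⟶ d), R g →
      ∃ z : Z.obj.obj (Opposite.op e),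
        m.hom.app _ z = f.hom.app _ (W.obj.map g.op s)) :
    ∃ k : W ⟶ Z, k ≫ m = f := by
  have hsurj : Sheaf.IsLocallySurjective (pullback.fst f m) := by
    refine ⟨fun {d} s => ?_⟩
    obtain ⟨R, hR, hlift⟩ := h d s
    refine J.superset_covering (fun e g hg => ?_) hR
    obtain ⟨z, hz⟩ := hlift e g hg
    obtain ⟨y, hy, -⟩ := Types.exists_of_isPullback ((IsPullback.of_hasPullback f m).map
      (sheafToPresheaf J (Type u) ⋙ (evaluation _ _).obj (Opposite.op e))) _ z hz.symm
    exact ⟨y, hy⟩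
  have hepi : Epi (pullback.fst f m) := (Sheaf.isLocallySurjective_iff_epi _).1 hsurj
  have : IsIso (pullback.fst f m) := isIso_of_mono_of_epi _
  exact ⟨inv (pullback.fst f m) ≫ pullback.snd f m, by
    rw [Category.assoc, ← pullback.condition, IsIso.inv_hom_id_assoc]⟩

variable {B : Type u} [DistribLattice B] [BoundedOrder B]

theorem nonempty_obj_bot (F : Sheaf (finiteJoinTopology B) (Type u)) :
    Nonempty (F.obj.obj (Opposite.op ⊥)) := by
  have hF := F.property.isSheafFor (⊥ : Sieve (⊥ : B)) ⟨∅, by simp, by simp⟩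
  obtain ⟨t, -⟩ := hF (fun _ _ h => h.elim) (fun _ _ _ _ _ _ _ h => h.elim)
  exact ⟨t⟩

/-- The initial sheaf, as the sheaf represented by the least element. -/
def emptySheaf (B : Type u) [DistribLattice B] [BoundedOrder B] :
    Sheaf (finiteJoinTopology B) (Type u) where
  obj := yoneda.obj ⊥
  property := by
    rw [isSheaf_iff_isSheaf_of_type]
    rintro b R ⟨s, hs, hsup⟩ x -
    have hb : b ≤ ⊥ := by
      rw [← hsup]
      refine Finset.sup_le fun a ha => ?_
      obtain ⟨f, hf⟩ := hs a ha
      exact leOfHom (x f hf)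
    exact ⟨homOfLE hb, fun c _ _ => Subsingleton.elim (α := (c ⟶ ⊥)) _ _,
      fun _ _ => Subsingleton.elim (α := (b ⟶ ⊥)) _ _⟩

/-- A sheaf without proper subobjects has sections over the least element only. -/
theorem eq_bot_of_isBot_top {F : Sheaf (finiteJoinTopology B) (Type u)}
    (hF : IsBot (⊤ : Subobject F)) {b : B} (s : F.obj.obj (Opposite.op b)) : b = ⊥ := by
  let m : emptySheaf B ⟶ F := ⟨yonedaEquiv.symm (nonempty_obj_bot F).some⟩
  have : Mono m := by
    refine ⟨fun g h _ => ?_⟩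
    ext c z
    exact Subsingleton.elim (α := (c.unop ⟶ ⊥)) _ _
  have hle : ⊤ ≤ Subobject.mk m := hF _
  rw [Subobject.top_eq_id] at hle
  exact le_bot_iff.1 (leOfHom ((Subobject.ofMkLEMk _ _ hle).hom.app _ s))

end Sheaves

/-! ### The sheaf of germs -/

section GermSheaf

variable {B : Type u} [CompleteBooleanAlgebra B] {C : Type u} [SmallCategory C]

/-- The trace of a filter on the clopen set of `b`. -/
def traceFilter (G : Filter (StonePoint B)) (b : B) : Filter (StonePoint B) :=
  G ⊓ Filter.principal (stoneSet b)

theorem eventually_traceFilter {G : Filter (StonePoint B)} {b : B} {p : StonePoint B → Prop} :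
    (∀ᶠ x in traceFilter G b, p x) ↔ ∀ᶠ x in G, x ∈ stoneSet b → p x :=
  Filter.eventually_inf_principal

theorem traceFilter_mono (G : Filter (StonePoint B)) {a b : B} (h : a ≤ b) :
    traceFilter G a ≤ traceFilter G b :=
  inf_le_inf_left _ (Filter.principal_mono.2 fun _ hx => mem_stoneSet_of_le h hx)

/-- Germs of partial sections, over all elements of `B`. -/
def germPresheaf (G : Filter (StonePoint B)) (N : StonePoint B → Type u) : Bᵒᵖ ⥤ Type u where
  obj b := ReducedProduct (traceFilter G b.unop) N
  map f := ↾ ReducedProduct.restrict (traceFilter_mono G (leOfHom f.unop))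
  map_id b := by
    ext z
    obtain ⟨f, hf, rfl⟩ := ReducedProduct.exists_mk z
    rfl
  map_comp f g := by
    ext z
    obtain ⟨f, hf, rfl⟩ := ReducedProduct.exists_mk z
    rfl

/-- Finitely many compatible germs are glued by choosing at each point any one of the given
partial sections that is available there. -/
theorem isSheaf_germPresheaf (G : Filter (StonePoint B)) (N : StonePoint B → Type u) :
    Presheaf.IsSheaf (finiteJoinTopology B) (germPresheaf G N) := by
  classical
  rw [isSheaf_iff_isSheaf_of_type]
  rintro b R ⟨s, hs, hsup⟩ z hz
  choose i hi using hs
  have hrep : ∀ (c : B) (g : c ⟶ b) (hg : R g), ∃ f hf, z g hg = ReducedProduct.mk f hf :=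
    fun c g hg => ReducedProduct.exists_mk _
  choose f hf hzf using hrep
  have hcompat : ∀ {c d : B} (g : c ⟶ b) (hg : R g) (h : d ⟶ b) (hh : R h),
      ∀ᶠ x in G, x ∈ stoneSet c → x ∈ stoneSet d → f c g hg x = f d h hh x := by
    intro c d g hg h hh
    have e := hz (homOfLE inf_le_left : c ⊓ d ⟶ c) (homOfLE inf_le_right) hg hh
      (Subsingleton.elim _ _)
    rw [hzf, hzf] at e
    filter_upwards [eventually_traceFilter.1 (ReducedProduct.mk_eq_mk.1 e)] with x hx hc hd
    exact hx (mem_stoneSet_inf.2 ⟨hc, hd⟩)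
  let φ : s → ∀ x, Option (N x) := fun a => f a.1 (i a.1 a.2) (hi a.1 a.2)
  let F : ∀ x, Option (N x) := fun x =>
    if h : ∃ a : s, x ∈ stoneSet a.1 ∧ (φ a x).isSome then φ h.choose x else none
  have hF : ∀ᶠ x in G, ∀ a : s, x ∈ stoneSet a.1 → F x = φ a x ∧ (φ a x).isSome := by
    have h1 : ∀ᶠ x in G, ∀ a a' : s, x ∈ stoneSet a.1 → x ∈ stoneSet a'.1 → φ a x = φ a' x :=
      Filter.eventually_all.2 fun a => Filter.eventually_all.2 fun a' => hcompat _ _ _ _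
    have h2 : ∀ᶠ x in G, ∀ a : s, x ∈ stoneSet a.1 → (φ a x).isSome :=
      Filter.eventually_all.2 fun a => eventually_traceFilter.1 (hf _ _ _)
    filter_upwards [h1, h2] with x h1 h2 a ha
    have h : ∃ a : s, x ∈ stoneSet a.1 ∧ (φ a x).isSome := ⟨a, ha, h2 a ha⟩
    exact ⟨(dif_pos h).trans (h1 _ _ h.choose_spec.1 ha), h2 a ha⟩
  have hcover : ∀ {x}, x ∈ stoneSet b → ∃ a : s, x ∈ stoneSet a.1 := by
    intro x hx
    rw [← hsup] at hx
    obtain ⟨a, ha, hxa⟩ := exists_mem_stoneSet_of_mem_stoneSet_sup hx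
    exact ⟨⟨a, ha⟩, hxa⟩
  have hF' : ∀ᶠ x in traceFilter G b, (F x).isSome := by
    rw [eventually_traceFilter]
    filter_upwards [hF] with x hx hxb
    obtain ⟨a, ha⟩ := hcover hxb
    rw [(hx a ha).1]
    exact (hx a ha).2
  refine ⟨ReducedProduct.mk F hF', ?_, ?_⟩
  · intro c g hg
    rw [hzf]
    refine ReducedProduct.mk_eq_mk.2 (eventually_traceFilter.2 ?_)
    have h1 : ∀ᶠ x in G, ∀ a : s, x ∈ stoneSet a.1 → x ∈ stoneSet c → φ a x = f c g hg x :=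
      Filter.eventually_all.2 fun a => hcompat _ _ _ _
    filter_upwards [hF, h1] with x hx h1 hxc
    obtain ⟨a, ha⟩ := hcover (mem_stoneSet_of_le (leOfHom g) hxc)
    rw [(hx a ha).1, h1 a ha hxc]
  · intro t ht
    obtain ⟨t, htt, rfl⟩ := ReducedProduct.exists_mk t
    refine ReducedProduct.mk_eq_mk.2 (eventually_traceFilter.2 ?_)
    have h1 : ∀ᶠ x in G, ∀ a : s, x ∈ stoneSet a.1 → t x = φ a x := by
      refine Filter.eventually_all.2 fun a => ?_
      have e := ht (i a.1 a.2) (hi a.1 a.2)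
      rw [hzf] at e
      exact eventually_traceFilter.1 (ReducedProduct.mk_eq_mk.1 e)
    filter_upwards [hF, h1] with x hx h1 hxb
    obtain ⟨a, ha⟩ := hcover hxb
    rw [(hx a ha).1, h1 a ha]

/-- The sheaves of germs of a family of functors. -/
def germSheaf (G : Filter (StonePoint B)) (N : StonePoint B → C ⥤ Type u) :
    C ⥤ Sheaf (finiteJoinTopology B) (Type u) where
  obj X := ⟨germPresheaf G fun x => (N x).obj X, isSheaf_germPresheaf _ _⟩
  map f := ⟨{
    app b := (ReducedProduct.functor (traceFilter G b.unop) N).map f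
    naturality b c g := by
      ext z
      obtain ⟨f, hf, rfl⟩ := ReducedProduct.exists_mk z
      rfl }⟩
  map_id X := by
    ext b z
    exact ConcreteCategory.congr_hom
      ((ReducedProduct.functor (traceFilter G b.unop) N).map_id X) z
  map_comp f g := by
    ext b z
    exact ConcreteCategory.congr_hom
      ((ReducedProduct.functor (traceFilter G b.unop) N).map_comp f g) z

theorem preservesFiniteLimits_germSheaf [HasFiniteLimits C] (G : Filter (StonePoint B))
    (N : StonePoint B → C ⥤ Type u) [∀ x, PreservesFiniteLimits (N x)] :
    PreservesFiniteLimits (germSheaf G N) := by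
  have h : PreservesFiniteLimits (germSheaf G N ⋙ sheafToPresheaf _ _) := by
    refine preservesFiniteLimits_of_evaluation _ fun b => ?_
    exact ReducedProduct.preservesFiniteLimits_functor (traceFilter G b.unop) N
  exact preservesFiniteLimits_of_reflects_of_preserves _ (sheafToPresheaf _ _)

variable [CoherentCategory C]

/-- Sheaves of germs of set-valued models form a model. Unions are preserved because, modulo `G`,
every set of points is clopen, so that a germ can be split along the set where it takes values in
the first subobject. -/
theorem coherentFunctor_germSheaf {G : Filter (StonePoint B)} (hG : Minimal IsSeparating G)
    {N : StonePoint B → C ⥤ Type u} (hN : ∀ x, IsSetModel (N x)) :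
    CoherentFunctor (germSheaf G N) := by
  classical
  have hlim := fun x => (hN x).preservesFiniteLimits
  have hlex := preservesFiniteLimits_germSheaf G N
  -- regular epimorphisms are pointwise surjective and the empty subobject is covered by the empty
  -- sieve; unions are treated last
  refine { hlex with map_regularEpi := ?_, map_bot := ?_, map_sup := ?_ }
  · intro X Y f hf
    have : Sheaf.IsLocallySurjective ((germSheaf G N).map f) :=
      Presheaf.isLocallySurjective_of_surjective _ _ fun b =>
        ReducedProduct.map_surjective fun x => (hN x).surjective f hf
    have : Epi ((germSheaf G N).map f) := (Sheaf.isLocallySurjective_iff_epi _).1 this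
    exact ⟨⟨regularEpiOfEpi _⟩⟩
  · intro X b hb S
    obtain ⟨k, hk⟩ := exists_comp_eq_of_locally ((germSheaf G N).map b.arrow) S.arrow (by
      intro d s
      obtain ⟨f, hf, rfl⟩ := ReducedProduct.exists_mk s
      refine ⟨⊥, ⟨∅, by simp, ?_⟩, fun e g hg => hg.elim⟩
      have := hG.1 dᶜ (by
        filter_upwards [eventually_traceFilter.1 hf] with x hx
        rw [mem_stoneSet_compl]
        intro hxd
        exact ((hN x).isEmpty b hb).false ((f x).get (hx hxd)))
      rw [Finset.sup_empty]
      exact (compl_eq_top.1 this).symm)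
    exact Subobject.mk_le_of_comm k hk
  · intro X a b c h
    refine ⟨?_, ?_⟩
    · have key : ∀ {d : Subobject X}, d ≤ c →
          mapSubobject (germSheaf G N) d ≤ mapSubobject (germSheaf G N) c := fun {d} hd =>
        Subobject.mk_le_mk_of_comm ((germSheaf G N).map (Subobject.ofLE d c hd)) (by
          rw [← Functor.map_comp, Subobject.ofLE_arrow])
      rintro _ (rfl | rfl)
      exacts [key (h.1 (Set.mem_insert _ _)), key (h.1 (Set.mem_insert_of_mem _ rfl))]
    · intro S hS
      -- a germ with values in a subobject below `S` lifts to `S`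
      have lift : ∀ (d : Subobject X), mapSubobject (germSheaf G N) d ≤ S →
          ∀ (e : B) (f : ∀ x, Option ((N x).obj (c : C)))
            (hf : ∀ᶠ x in traceFilter G e, (f x).isSome),
          (∀ᶠ x in G, x ∈ stoneSet e → ∀ z, f x = some z →
            ∃ y, (N x).map d.arrow y = (N x).map c.arrow z) →
          ∃ z, S.arrow.hom.app (Opposite.op e) z =
            ((germSheaf G N).map c.arrow).hom.app _ (ReducedProduct.mk f hf) := by
        intro d hd e f hf hy
        have hy' : ∀ x, ∃ y : Option ((N x).obj (d : C)),
            (x ∈ stoneSet e → ∀ z, f x = some z →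
              ∃ y, (N x).map d.arrow y = (N x).map c.arrow z) →
            x ∈ stoneSet e → (f x).isSome →
            y.isSome ∧ y.map ((N x).map d.arrow) = (f x).map ((N x).map c.arrow) := by
          intro x
          by_cases hx : x ∈ stoneSet e ∧ (f x).isSome ∧ ∀ z, f x = some z →
              ∃ y, (N x).map d.arrow y = (N x).map c.arrow z
          · obtain ⟨hx, hs, hx'⟩ := hx
            obtain ⟨z, hz⟩ := Option.isSome_iff_exists.1 hs
            obtain ⟨y, hy⟩ := hx' z hz
            exact ⟨some y, fun _ _ _ => by simp [hz, hy]⟩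
          · exact ⟨none, fun h1 h2 h3 => absurd ⟨h2, h3, h1 h2⟩ hx⟩
        choose y hy' using hy'
        have hev : ∀ᶠ x in traceFilter G e,
            (y x).isSome ∧ (y x).map ((N x).map d.arrow) = (f x).map ((N x).map c.arrow) := by
          rw [eventually_traceFilter]
          filter_upwards [hy, eventually_traceFilter.1 hf] with x h1 h2 hx
          exact hy' x h1 hx (h2 hx)
        refine ⟨(Subobject.ofMkLE _ S hd).hom.app _
          (ReducedProduct.mk y (hev.mono fun x hx => hx.1)), ?_⟩
        have e1 := congr_app ((sheafToPresheaf _ _).congr_map (Subobject.ofMkLE_arrow hd))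
          (Opposite.op e)
        refine (ConcreteCategory.congr_hom e1 (ReducedProduct.mk y (hev.mono fun x hx => hx.1) :
          ReducedProduct (traceFilter G e) fun x => (N x).obj (d : C))).trans ?_
        exact ReducedProduct.mk_eq_mk.2 (hev.mono fun x hx => hx.2)
      obtain ⟨k, hk⟩ := exists_comp_eq_of_locally ((germSheaf G N).map c.arrow) S.arrow (by
        intro d s
        obtain ⟨f, hf, rfl⟩ := ReducedProduct.exists_mk s
        -- `t` represents the set where the germ lies in `a`; it splits `d` into two pieces
        obtain ⟨t, ht⟩ := exists_eventually_iff_mem_stoneSet hG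
          {x | ∃ z, f x = some z ∧ ∃ y, (N x).map a.arrow y = (N x).map c.arrow z}
        refine ⟨Sieve.generate (Presieve.ofArrows (fun j : Bool => d ⊓ cond j t tᶜ)
          fun _ => homOfLE inf_le_left), ⟨{d ⊓ t, d ⊓ tᶜ}, ?_, ?_⟩, ?_⟩
        · intro e he
          rcases Finset.mem_insert.1 he with rfl | he
          · exact ⟨homOfLE inf_le_left, Sieve.le_generate _ _ _ (Presieve.ofArrows.mk true)⟩
          · obtain rfl := Finset.mem_singleton.1 he
            exact ⟨homOfLE inf_le_left, Sieve.le_generate _ _ _ (Presieve.ofArrows.mk false)⟩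
        · rw [Finset.sup_insert, Finset.sup_singleton, id, id, ← inf_sup_left, sup_compl_eq_top,
            inf_top_eq]
        · rintro e g ⟨_, g', _, ⟨j⟩, rfl⟩
          have hle := leOfHom g'
          cases j with
          | true =>
            refine lift a (hS (Set.mem_insert _ _)) e f _ ?_
            filter_upwards [ht] with x hx hxe z hz
            obtain ⟨z', hz', y, hy⟩ :=
              hx.2 (mem_stoneSet_inf.1 (mem_stoneSet_of_le hle hxe)).2
            exact ⟨y, hy.trans (by rw [Option.some.inj (hz.symm.trans hz')])⟩
          | false =>
            refine lift b (hS (Set.mem_insert_of_mem _ rfl)) e f _ ?_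
            filter_upwards [ht] with x hx hxe z hz
            have hxt := mem_stoneSet_compl.1 (mem_stoneSet_inf.1 (mem_stoneSet_of_le hle hxe)).2
            exact ((hN x).exists_of_isLUB h z).resolve_left fun hy => hxt (hx.1 ⟨z, hz, hy⟩))
      exact Subobject.mk_le_of_comm k hk

end GermSheaf

/-! ### Realizing types -/

section Realization

variable {B : Type u} [CompleteBooleanAlgebra B] {C : Type u} [SmallCategory C]
  [CoherentCategory C]

/-- The subterminal objects whose truth value under `p` contains the point `x`. -/
def subobjectsAt (p : Subobject (⊤_ C) ⥤ Sheaf (finiteJoinTopology B) (Type u))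
    (x : StonePoint B) : Set (Subobject (⊤_ C)) :=
  {a | ∃ b : B, x ∈ stoneSet b ∧ Nonempty ((p.obj a).obj.obj (Opposite.op b))}

/-- At each point, the subterminal objects that hold there form a proper filter, which is therefore
realized by a set-valued model. Only that `p` preserves finite limits and the empty union matters,
since `p` need only be dominated by the model. -/
theorem exists_isSetModel_subobjectsAt
    (p : Subobject (⊤_ C) ⥤ Sheaf (finiteJoinTopology B) (Type u)) [hp : CoherentFunctor p]
    (x : StonePoint B) :
    ∃ N : C ⥤ Type u, IsSetModel N ∧ ∀ a ∈ subobjectsAt p x, Nonempty (N.obj (a : C)) := by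
  let Γ : B → Sheaf (finiteJoinTopology B) (Type u) ⥤ Type u := fun b =>
    sheafToPresheaf _ _ ⋙ (evaluation _ _).obj (Opposite.op b)
  have htop : ∀ b, Unique ((p ⋙ Γ b).obj ⊤) := fun b =>
    Types.isTerminalEquivUnique _ (IsTerminal.isTerminalObj (p ⋙ Γ b) _ isTerminalTop)
  refine exists_isSetModel _ ⟨⊤, mem_stoneSet_top x, ⟨(htop ⊤).default⟩⟩ ?_ ?_
  · rintro a ⟨b, hb, ⟨s⟩⟩ a' ⟨b', hb', ⟨s'⟩⟩
    refine ⟨b ⊓ b', mem_stoneSet_inf.2 ⟨hb, hb'⟩, ?_⟩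
    have hpb : IsPullback (homOfLE (inf_le_left : a ⊓ a' ≤ a)) (homOfLE inf_le_right)
        (homOfLE (le_top : a ≤ ⊤)) (homOfLE (le_top : a' ≤ ⊤)) :=
      ⟨⟨Subsingleton.elim _ _⟩, ⟨PullbackCone.IsLimit.mk _
        (fun c => homOfLE (le_inf (leOfHom c.fst) (leOfHom c.snd)))
        (fun _ => Subsingleton.elim _ _) (fun _ => Subsingleton.elim _ _)
        (fun _ _ _ _ => Subsingleton.elim _ _)⟩⟩
    obtain ⟨y, -⟩ := Types.exists_of_isPullback (hpb.map (p ⋙ Γ (b ⊓ b')))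
      ((p.obj a).obj.map (homOfLE inf_le_left).op s)
      ((p.obj a').obj.map (homOfLE inf_le_right).op s') ((htop (b ⊓ b')).instSubsingleton.elim _ _)
    exact ⟨y⟩
  · rintro a ⟨b, hb, ⟨s⟩⟩ ha
    -- an object of a poset that is least has a single subobject
    have hbot : IsBot (⊤ : Subobject a) := fun S =>
      Subobject.le_of_comm (homOfLE ((leOfHom (⊤ : Subobject a).arrow).trans (ha _)))
        (Subsingleton.elim _ _)
    have h := hp.map_bot _ hbot
    have h' : mapSubobject p (⊤ : Subobject a) = ⊤ := Subobject.mk_eq_top_of_isIso _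
    rw [h'] at h
    obtain rfl := eq_bot_of_isBot_top h s
    exact notMem_stoneSet_bot x hb

end Realization

theorem mainTheorem4 (B : Type u) [CompleteBooleanAlgebra B] :
    CanRealizeTypes.{u} (Sheaf (finiteJoinTopology B) (Type u)) := by
  classical
  intro C _ _ p hp
  obtain ⟨G, hG⟩ := exists_minimal_isSeparating (B := B)
  choose N hN hpN using exists_isSetModel_subobjectsAt p
  have hlim := fun x => (hN x).preservesFiniteLimits
  refine ⟨germSheaf G N, coherentFunctor_germSheaf hG hN, ⟨?_⟩⟩
  have hsub : ∀ (a : Subobject (⊤_ C)) x, Subsingleton ((N x).obj (a : C)) := fun a x => by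
    have := (Types.isTerminalEquivUnique _
      (IsTerminal.isTerminalObj (N x) _ terminalIsTerminal)).instSubsingleton
    exact ((mono_iff_injective ((N x).map a.arrow)).1 inferInstance).subsingleton
  have hsub' : ∀ (a : Subobject (⊤_ C)) b,
      Subsingleton (((germSheaf G N).obj (a : C)).obj.obj b) := fun a b =>
    ReducedProduct.subsingleton (hsub a)
  refine
    { app a := ⟨{
        app b := ↾ fun s => ReducedProduct.mk
          (fun x => if h : Nonempty ((N x).obj (a : C)) then some h.some else none)
          (eventually_traceFilter.2 (Filter.Eventually.of_forall fun x hx => by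
            simp [hpN x a ⟨_, hx, ⟨s⟩⟩]))
        naturality b c f := by
          ext s
          exact (hsub' a c).elim _ _ }⟩
      naturality a a' f := by
        ext b s
        exact (hsub' a' b).elim _ _ }
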